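/- Let $G\subset GL_n(\mathbb C)$ be a finite group generated by complex reflections (elements $s\ne 1$ fixing a hyperplane of $V=\mathbb C^n$ pointwise). Let $S=\mathbb C[x_1,\dots,x_n]$ be the ring of polynomial functions on $V$, on which $G$ acts by $(g f)(v)=f(g^{-1}v)$, and let $R=S^G$. Let $A$ be the set of reflecting hyperplanes of $G$; for $H\in A$ let $\alpha_H\in S$ be a linear form with kernel $H$, and let $e_H$ be the order of the subgroup of $G$ fixing $H$ pointwise. Put $$z=\prod_{H\in A}\alpha_H,\qquad \Delta=\prod_{H\in A}\alpha_H^{e_H},$$ and for a $G$-orbit $\mathfrak O\subset A$ put $$j_{\mathfrak O}=\prod_{H\in\mathfrak O}\alpha_H,\qquad \Delta_{\mathfrak O}=\prod_{H\in\mathfrak O}\alpha_H^{e_H}.$$ For a linear character $\chi:G\to\mathbb C^\times$ let $S^G_\chi=\{f\in S: g f=\chi(g)f \text{ for all } g\in G\}$ be its isotypical component, an $R$-submodule of $S$, and let $\det$ be the linear character of $G$ given by the determinant of the action of $g$ on the space of linear forms $\langle x_1,\dots,x_n\rangle\subset S$. Then for every orbit $\mathfrak O$ the polynomials $\Delta$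 and $\Delta_{\mathfrak O}$ lie in $R$, the $R$-modules $S/(z)$ and $R/(\Delta_{\mathfrak O})$ are annihilated by $\Delta$, and $R/(\Delta_{\mathfrak O})$ is (isomorphic to) a direct summand of $S/(z)$ as an $R/(\Delta)$-module. More precisely, there is a linear character $\theta_{\mathfrak O}$ of $G$ with $g(j_{\mathfrak O})=\theta_{\mathfrak O}(g)\,j_{\mathfrak O}$ for all $g\in G$, and, for every $H\in\mathfrak O$ and $\theta=\theta_{\mathfrak O}^{\,e_H-1}$, multiplication by $z$ maps $S^G_{\theta}$ into $S^G_{\theta\otimes\det}$, the cokernel of $z|_{\theta}:S^G_{\theta}\to S^G_{\theta\otimes\det}$ is annihilated by $\Delta$ and is isomorphic to $R/(\Delta_{\mathfrak O})$ as an $R/(\Delta)$-module, and the map $S^G_{\theta\otimes\det}/zS^G_{\theta}\to S/(z)$ induced by the inclusion $S^G_{\theta\otimes\det}\subset S$ is an isomorphism onto a direct summand of the $R/(\Delta)$-module $S/(z)$. -/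

import Mathlib

open scoped Matrix

noncomputable section

namespace ComplexReflection

/-- The polynomial ring `S = ℂ[x₁, …, xₙ]`, viewed as the ring of polynomial functions on
`V = ℂⁿ`. -/
abbrev PolyRing (n : ℕ) : Type := MvPolynomial (Fin n) ℂ

/-- The action of a linear automorphism `g` of `V = ℂⁿ` on `S`: it is the algebra map extending
the contragredient action on the linear forms, so that `(g • f)(v) = f (g⁻¹ v)`
(see `eval_act`). -/
def act {n : ℕ} (g : GL (Fin n) ℂ) : PolyRing n →ₐ[ℂ] PolyRing n :=
  MvPolynomial.aeval fun i =>
    ∑ j, MvPolynomial.C (((g⁻¹ : GL (Fin n) ℂ) : Matrix (Fin n) (Fin n) ℂ) i j) *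
      MvPolynomial.X j

theorem eval_act {n : ℕ} (g : GL (Fin n) ℂ) (f : PolyRing n) (v : Fin n → ℂ) :
    MvPolynomial.eval v (act g f) =
      MvPolynomial.eval (((g⁻¹ : GL (Fin n) ℂ) : Matrix (Fin n) (Fin n) ℂ) *ᵥ v) f := by
  induction f using MvPolynomial.induction_on with
  | C a => simp [act]
  | add p q hp hq => simp [hp, hq]
  | mul_X p i hp =>
    rw [map_mul, map_mul, hp, map_mul]
    simp [act, Matrix.mulVec, dotProduct]

/-- `g` fixes the subspace `H` of `V = ℂⁿ` pointwise. -/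
def FixesPointwise {n : ℕ} (g : GL (Fin n) ℂ) (H : Submodule ℂ (Fin n → ℂ)) : Prop :=
  ∀ v ∈ H, (g : Matrix (Fin n) (Fin n) ℂ) *ᵥ v = v

/-- A complex reflection: an automorphism of `V`, not the identity, that fixes a hyperplane
pointwise (hyperplanes are the maximal proper subspaces). For elements of finite order, the only
ones considered below, such a map is automatically diagonalisable. -/
def IsReflection {n : ℕ} (s : GL (Fin n) ℂ) : Prop :=
  s ≠ 1 ∧ ∃ H : Submodule ℂ (Fin n → ℂ), IsCoatom H ∧ FixesPointwise s H

/-- `G` is generated by the complex reflections it contains. -/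
def IsReflectionGroup {n : ℕ} (G : Subgroup (GL (Fin n) ℂ)) : Prop :=
  Subgroup.closure {s | s ∈ G ∧ IsReflection s} = G

/-- The set `A(G)` of reflecting hyperplanes of `G`. -/
def reflectingHyperplanes {n : ℕ} (G : Subgroup (GL (Fin n) ℂ)) :
    Set (Submodule ℂ (Fin n → ℂ)) :=
  {H | IsCoatom H ∧ ∃ s ∈ G, s ≠ 1 ∧ FixesPointwise s H}

/-- A finite group has finitely many reflecting hyperplanes, so that the products over them
below are genuine finite products. -/
theorem finite_reflectingHyperplanes {n : ℕ} (G : Subgroup (GL (Fin n) ℂ)) [Finite G] :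
    (reflectingHyperplanes G).Finite := by
  have key : ∀ (s : GL (Fin n) ℂ) (H : Submodule ℂ (Fin n → ℂ)), IsCoatom H → s ≠ 1 →
      FixesPointwise s H →
      H = LinearMap.ker (Matrix.mulVecLin ((s : Matrix (Fin n) (Fin n) ℂ) - 1)) := by
    intro s H hH hs hf
    have hle : H ≤ LinearMap.ker (Matrix.mulVecLin ((s : Matrix (Fin n) (Fin n) ℂ) - 1)) := by
      intro v hv
      simp [hf v hv]
    rcases hle.eq_or_lt with h | h
    · exact h
    · exfalso
      have h0 := LinearMap.ker_eq_top.mp (hH.2 _ h)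
      apply hs
      have h1 : (s : Matrix (Fin n) (Fin n) ℂ) - 1 = 0 :=
        Matrix.toLin'.injective (by rw [Matrix.toLin'_apply', h0, map_zero])
      exact Units.ext (sub_eq_zero.mp h1)
  refine (Set.finite_range (fun s : G => LinearMap.ker
    (Matrix.mulVecLin (((s : GL (Fin n) ℂ) : Matrix (Fin n) (Fin n) ℂ) - 1)))).subset ?_
  rintro H ⟨hH, s, hsG, hs, hf⟩
  exact ⟨⟨s, hsG⟩, (key s H hH hs hf).symm⟩

/-- The set `A(G)/G` of orbits of reflecting hyperplanes under `H ↦ gH`. -/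
def hyperplaneOrbits {n : ℕ} (G : Subgroup (GL (Fin n) ℂ)) :
    Set (Set (Submodule ℂ (Fin n → ℂ))) :=
  {O | ∃ H ∈ reflectingHyperplanes G,
    O = {K | ∃ g ∈ G, K = H.map (Matrix.mulVecLin (g : Matrix (Fin n) (Fin n) ℂ))}}

/-- The order `e_H` of the subgroup `G(H)` of `G` fixing `H` pointwise. -/
def fixerOrder {n : ℕ} (G : Subgroup (GL (Fin n) ℂ)) (H : Submodule ℂ (Fin n → ℂ)) : ℕ :=
  Nat.card {g : GL (Fin n) ℂ // g ∈ G ∧ FixesPointwise g H}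

/-- `f ∈ S` is a defining linear equation of `H`: a linear form with kernel `H`. -/
def IsDefiningForm {n : ℕ} (H : Submodule ℂ (Fin n → ℂ)) (f : PolyRing n) : Prop :=
  f.IsHomogeneous 1 ∧ ∀ v : Fin n → ℂ, v ∈ H ↔ MvPolynomial.eval v f = 0

/-- The invariant ring `R = S^G`. -/
def invariantRing {n : ℕ} (G : Subgroup (GL (Fin n) ℂ)) : Subring (PolyRing n) where
  carrier := {f | ∀ g ∈ G, act g f = f}
  mul_mem' := fun ha hb g hg => by rw [map_mul, ha g hg, hb g hg]
  add_mem' := fun ha hb g hg => by rw [map_add, ha g hg, hb g hg]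
  one_mem' := fun g _ => map_one (act g)
  zero_mem' := fun g _ => map_zero (act g)
  neg_mem' := fun ha g hg => by rw [map_neg, ha g hg]

/-- The quotient `S/I` as an `R`-module (a shortcut to the instance in Mathlib). -/
instance quotientModule {n : ℕ} (G : Subgroup (GL (Fin n) ℂ)) (I : Ideal (PolyRing n)) :
    Module (invariantRing G) (PolyRing n ⧸ I) :=
  Submodule.Quotient.module' I

/-- The isotypical component of `S` of a linear character `χ` of `G`, that is, its relative
invariants, as an `R`-submodule of `S`. -/
def isotypic {n : ℕ} (G : Subgroup (GL (Fin n) ℂ)) (χ : G →* ℂˣ) :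
    Submodule (invariantRing G) (PolyRing n) where
  carrier := {f | ∀ g : G, act (g : GL (Fin n) ℂ) f = MvPolynomial.C (χ g : ℂ) * f}
  add_mem' := fun ha hb g => by rw [map_add, ha g, hb g, mul_add]
  zero_mem' := fun g => by rw [map_zero, mul_zero]
  smul_mem' := fun r f hf g => by
    rw [Algebra.smul_def, map_mul, hf g]
    have hr : act (g : GL (Fin n) ℂ) (algebraMap (invariantRing G) (PolyRing n) r) =
        algebraMap (invariantRing G) (PolyRing n) r := r.2 g g.2
    rw [hr]
    ring

/-- The linear character of `G` given by the determinant of the action on the space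
`V* = ⟨x₁, …, xₙ⟩` of linear forms in `S`; as `g` acts there contragrediently, this is
`g ↦ (det g)⁻¹`. -/
def detChar {n : ℕ} (G : Subgroup (GL (Fin n) ℂ)) : G →* ℂˣ :=
  (Matrix.GeneralLinearGroup.det.comp G.subtype)⁻¹

/-- `M` is (isomorphic to) a direct summand of `N` as an `A`-module. -/
def IsDirectSummand (A M N : Type*) [Ring A] [AddCommGroup M] [Module A M]
    [AddCommGroup N] [Module A N] : Prop :=
  ∃ P Q : Submodule A N, IsCompl P Q ∧ Nonempty (M ≃ₗ[A] P)

/-- Multiplication by `z`, restricted to a map from the isotypical component of `χ` to that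
of `ψ`. -/
def mulRestrict {n : ℕ} (G : Subgroup (GL (Fin n) ℂ)) (z : PolyRing n) (χ ψ : G →* ℂˣ)
    (hz : ∀ f ∈ isotypic G χ, z * f ∈ isotypic G ψ) :
    isotypic G χ →ₗ[invariantRing G] isotypic G ψ :=
  (LinearMap.mulLeft (invariantRing G) z).restrict hz

/-- The cokernel of `z|_χ : S_χ → S_ψ`. -/
abbrev CokerMul {n : ℕ} (G : Subgroup (GL (Fin n) ℂ)) (z : PolyRing n) (χ ψ : G →* ℂˣ)
    (hz : ∀ f ∈ isotypic G χ, z * f ∈ isotypic G ψ) : Type :=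
  isotypic G ψ ⧸ LinearMap.range (mulRestrict G z χ ψ hz)

end ComplexReflection

end

open ComplexReflection

namespace ComplexReflection

variable {n : ℕ}

/-! Let `j` be the product of the forms over the orbit, `y` the product over the remaining
reflecting hyperplanes, so that `z = y j`, and let `e` be the common fixer order on the orbit. The
two isotypical components are free of rank one over `R`: that of `θ ^ (e - 1)` is `R j ^ (e - 1)`
and that of `θ ^ (e - 1) * det` is `R y`. Since `z j ^ (e - 1) = y j ^ e = ΔO y`, the cokernel of
`z` is `R/(ΔO)` (`nonempty_cokerMul_equiv`).

The generators come from one observation: if `s` fixes `H` pointwise and `χ s ≠ 1`, a relative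
invariant of `χ` vanishes on `H`, hence is divisible by the form of `H`. Such `s` exist because the
determinant is injective on the fixer of `H`, while `ℂ` has at most `k` roots of unity of order
dividing `k` (`exists_det_pow_ne_one`). Characters need only be compared on reflections, where `θ`
is `detChar` for hyperplanes in the orbit and trivial for the others.

The splitting comes from averaging. As `z` is a relative invariant of `detChar`, the Reynolds
projections commute with multiplication by `z` (`reynolds_mul`), so the projection of `S` descends
to a retraction of `S/(z)` onto the cokernel. All modules involved are killed by `Δ`, so `R`-linear
maps are automatically `R/(Δ)`-linear. -/

theorem exists_linearMap_of_isHomogeneous_one {f : PolyRing n} (hf : f.IsHomogeneous 1) :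
    ∃ l : (Fin n → ℂ) →ₗ[ℂ] ℂ, ∀ v, MvPolynomial.eval v f = l v := by
  have hf' : f ∈ MvPolynomial.homogeneousSubmodule (Fin n) ℂ 1 := hf
  rw [MvPolynomial.homogeneousSubmodule_one_eq_span_X] at hf'
  induction hf' using Submodule.span_induction with
  | mem x hx =>
    obtain ⟨i, rfl⟩ := hx
    exact ⟨LinearMap.proj i, fun v => by simp⟩
  | zero => exact ⟨0, fun v => by simp⟩
  | add x y hx hy ihx ihy =>
    rw [← MvPolynomial.homogeneousSubmodule_one_eq_span_X] at hx hy
    obtain ⟨l, hl⟩ := ihx hx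
    obtain ⟨m, hm⟩ := ihy hy
    exact ⟨l + m, fun v => by simp [hl, hm]⟩
  | smul c x hx ih =>
    rw [← MvPolynomial.homogeneousSubmodule_one_eq_span_X] at hx
    obtain ⟨l, hl⟩ := ih hx
    exact ⟨c • l, fun v => by simp [hl]⟩

/-! ### The action on polynomials -/

theorem act_one (f : PolyRing n) : act 1 f = f :=
  MvPolynomial.funext fun v => by simp [eval_act]

theorem act_mul (g h : GL (Fin n) ℂ) (f : PolyRing n) : act (g * h) f = act g (act h f) :=
  MvPolynomial.funext fun v => by simp [eval_act, Matrix.mulVec_mulVec]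

theorem act_C (g : GL (Fin n) ℂ) (c : ℂ) : act g (MvPolynomial.C c) = MvPolynomial.C c := by
  simp [act]

theorem act_isHomogeneous_one (g : GL (Fin n) ℂ) {f : PolyRing n} (hf : f.IsHomogeneous 1) :
    (act g f).IsHomogeneous 1 := by
  have h := hf.aeval (fun i => ∑ j, MvPolynomial.C
    (((g⁻¹ : GL (Fin n) ℂ) : Matrix (Fin n) (Fin n) ℂ) i j) * MvPolynomial.X j) (n := 1)
    (fun i => MvPolynomial.IsHomogeneous.sum _ _ _ fun j _ =>
      MvPolynomial.isHomogeneous_C_mul_X _ _)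
  simpa [act] using h

/-! ### Defining forms of hyperplanes -/

section DefiningForm

variable {H K : Submodule ℂ (Fin n → ℂ)} {a b : PolyRing n}

theorem IsDefiningForm.exists_dual (hH : IsCoatom H) (ha : IsDefiningForm H a) :
    ∃ (l : (Fin n → ℂ) →ₗ[ℂ] ℂ) (w : Fin n → ℂ), (∀ v, MvPolynomial.eval v a = l v) ∧
      (∀ v, v ∈ H ↔ l v = 0) ∧ l w = 1 := by
  obtain ⟨l, hl⟩ := exists_linearMap_of_isHomogeneous_one ha.1
  have hmem : ∀ v, v ∈ H ↔ l v = 0 := fun v => by rw [ha.2, hl]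
  obtain ⟨u, hu⟩ : ∃ u, u ∉ H := by
    by_contra! h
    exact hH.1 (eq_top_iff.mpr fun v _ => h v)
  rw [hmem] at hu
  exact ⟨l, (l u)⁻¹ • u, hl, hmem, by simp [hu]⟩

theorem IsDefiningForm.ne_zero (hH : IsCoatom H) (ha : IsDefiningForm H a) : a ≠ 0 := by
  rintro rfl
  obtain ⟨l, w, hl, -, hw⟩ := ha.exists_dual hH
  simpa [hw] using hl w

/-- The ideal of a hyperplane is the kernel of the restriction along a linear projection onto
the hyperplane. -/
theorem IsDefiningForm.exists_restriction (hH : IsCoatom H) (ha : IsDefiningForm H a) :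
    ∃ r : PolyRing n →ₐ[ℂ] PolyRing n, (∀ f, a ∣ f ↔ r f = 0) ∧
      ∀ f, r f = 0 ↔ ∀ v ∈ H, MvPolynomial.eval v f = 0 := by
  obtain ⟨l, w, hl, hmem, hw⟩ := ha.exists_dual hH
  let r : PolyRing n →ₐ[ℂ] PolyRing n :=
    MvPolynomial.aeval fun i => MvPolynomial.X i - a * MvPolynomial.C (w i)
  have heval : ∀ v f, MvPolynomial.eval v (r f) = MvPolynomial.eval (v - l v • w) f := by
    intro v f
    induction f using MvPolynomial.induction_on with
    | C c => simp [r]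
    | add p q hp hq => simp [hp, hq]
    | mul_X p i hp => rw [map_mul, map_mul, hp, map_mul]; simp [r, hl]
  have hzero : ∀ f, r f = 0 ↔ ∀ v ∈ H, MvPolynomial.eval v f = 0 := by
    intro f
    constructor
    · intro h v hv
      have := heval v f
      rw [h, (hmem v).mp hv] at this
      simpa using this.symm
    · intro h
      refine MvPolynomial.funext fun v => ?_
      rw [heval, map_zero]
      exact h _ ((hmem _).mpr (by simp [hw]))
  refine ⟨r, fun f => ⟨?_, fun h => ?_⟩, hzero⟩
  · rintro ⟨q, rfl⟩
    exact (hzero _).mpr fun v hv => by rw [map_mul, (ha.2 v).mp hv, zero_mul]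
  -- Modulo `a` the substitution `r` is the identity on the variables, so `r f = 0` forces `f ≡ 0`.
  · have hq : (Ideal.Quotient.mkₐ ℂ (Ideal.span {a})).comp r =
        Ideal.Quotient.mkₐ ℂ (Ideal.span {a}) := by
      refine MvPolynomial.algHom_ext fun i => ?_
      simp only [AlgHom.comp_apply, r, MvPolynomial.aeval_X, Ideal.Quotient.mkₐ_eq_mk]
      rw [Ideal.Quotient.eq, Ideal.mem_span_singleton]
      exact ⟨-MvPolynomial.C (w i), by ring⟩
    have := DFunLike.congr_fun hq f
    rw [AlgHom.comp_apply, h, map_zero, Ideal.Quotient.mkₐ_eq_mk] at this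
    exact Ideal.mem_span_singleton.mp (Ideal.Quotient.eq_zero_iff_mem.mp this.symm)

theorem IsDefiningForm.dvd_iff (hH : IsCoatom H) (ha : IsDefiningForm H a) (f : PolyRing n) :
    a ∣ f ↔ ∀ v ∈ H, MvPolynomial.eval v f = 0 := by
  obtain ⟨r, h1, h2⟩ := ha.exists_restriction hH
  rw [h1, h2]

/-- The multiples of `a` are the kernel of an algebra map into a domain. -/
theorem IsDefiningForm.prime (hH : IsCoatom H) (ha : IsDefiningForm H a) : Prime a := by
  obtain ⟨r, h1, -⟩ := ha.exists_restriction hH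
  refine ⟨ha.ne_zero hH, fun hu => ?_, fun f g hfg => ?_⟩
  · have := (h1 1).mp hu.dvd
    simp at this
  · simpa only [h1, map_mul, mul_eq_zero] using hfg

theorem IsDefiningForm.dvd_iff_eq (hH : IsCoatom H) (hK : IsCoatom K) (ha : IsDefiningForm H a)
    (hb : IsDefiningForm K b) : a ∣ b ↔ H = K := by
  rw [ha.dvd_iff hH]
  simp_rw [← hb.2]
  refine ⟨fun h => ?_, fun h v hv => h ▸ hv⟩
  exact (hH.le_iff.mp (show H ≤ K from h)).elim (fun h => absurd h hK.1) (fun h => h.symm)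

theorem IsDefiningForm.eq_C_mul (hH : IsCoatom H) (ha : IsDefiningForm H a)
    (hb : IsDefiningForm H b) : ∃ c : ℂ, c ≠ 0 ∧ b = MvPolynomial.C c * a := by
  obtain ⟨l, w, hl, hmem, hw⟩ := ha.exists_dual hH
  obtain ⟨m, hm⟩ := exists_linearMap_of_isHomogeneous_one hb.1
  have key : ∀ v, m v = m w * l v := by
    intro v
    have h1 : v - l v • w ∈ H := (hmem _).mpr (by simp [hw])
    rw [hb.2, hm] at h1
    simp only [map_sub, map_smul, smul_eq_mul, sub_eq_zero] at h1
    rw [h1, mul_comm]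
  have hmw : b = MvPolynomial.C (m w) * a :=
    MvPolynomial.funext fun v => by simp [hl, hm, key v]
  refine ⟨m w, fun h0 => hb.ne_zero hH ?_, hmw⟩
  rw [hmw, h0, map_zero, zero_mul]

theorem mem_map_mulVecLin_iff (g : GL (Fin n) ℂ) (v : Fin n → ℂ) :
    v ∈ H.map (Matrix.mulVecLin (g : Matrix (Fin n) (Fin n) ℂ)) ↔
      ((g⁻¹ : GL (Fin n) ℂ) : Matrix (Fin n) (Fin n) ℂ) *ᵥ v ∈ H := by
  rw [Submodule.mem_map]
  constructor
  · rintro ⟨u, hu, rfl⟩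
    rw [Matrix.mulVecLin_apply, Matrix.mulVec_mulVec, ← Units.val_mul, inv_mul_cancel,
      Units.val_one, Matrix.one_mulVec]
    exact hu
  · intro h
    refine ⟨_, h, ?_⟩
    rw [Matrix.mulVecLin_apply, Matrix.mulVec_mulVec, ← Units.val_mul, mul_inv_cancel,
      Units.val_one, Matrix.one_mulVec]

theorem map_one_mulVecLin :
    H.map (Matrix.mulVecLin ((1 : GL (Fin n) ℂ) : Matrix (Fin n) (Fin n) ℂ)) = H := by
  ext v
  rw [mem_map_mulVecLin_iff]
  simp

theorem map_mul_mulVecLin (g h : GL (Fin n) ℂ) :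
    H.map (Matrix.mulVecLin ((g * h : GL (Fin n) ℂ) : Matrix (Fin n) (Fin n) ℂ)) =
      (H.map (Matrix.mulVecLin (h : Matrix (Fin n) (Fin n) ℂ))).map
        (Matrix.mulVecLin (g : Matrix (Fin n) (Fin n) ℂ)) := by
  ext v
  rw [mem_map_mulVecLin_iff, mem_map_mulVecLin_iff, mem_map_mulVecLin_iff, mul_inv_rev,
    Units.val_mul, Matrix.mulVec_mulVec]

theorem map_mulVecLin_injective (g : GL (Fin n) ℂ) :
    Function.Injective fun H : Submodule ℂ (Fin n → ℂ) =>
      H.map (Matrix.mulVecLin (g : Matrix (Fin n) (Fin n) ℂ)) := by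
  intro H K h
  have := congrArg (Submodule.map
    (Matrix.mulVecLin ((g⁻¹ : GL (Fin n) ℂ) : Matrix (Fin n) (Fin n) ℂ))) h
  simpa only [← map_mul_mulVecLin, inv_mul_cancel, map_one_mulVecLin] using this

theorem isCoatom_map (hH : IsCoatom H) (g : GL (Fin n) ℂ) :
    IsCoatom (H.map (Matrix.mulVecLin (g : Matrix (Fin n) (Fin n) ℂ))) := by
  refine ⟨fun h => hH.1 (eq_top_iff.mpr fun v _ => ?_), fun K hK => ?_⟩
  · have : (g : Matrix (Fin n) (Fin n) ℂ) *ᵥ v ∈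
        H.map (Matrix.mulVecLin (g : Matrix (Fin n) (Fin n) ℂ)) := h ▸ Submodule.mem_top
    rw [mem_map_mulVecLin_iff, Matrix.mulVec_mulVec, ← Units.val_mul, inv_mul_cancel] at this
    simpa using this
  · have h1 := hH.2 (K.map (Matrix.mulVecLin ((g⁻¹ : GL (Fin n) ℂ) : Matrix (Fin n) (Fin n) ℂ)))
    have h2 : H < K.map (Matrix.mulVecLin ((g⁻¹ : GL (Fin n) ℂ) : Matrix (Fin n) (Fin n) ℂ)) := by
      have := (Submodule.map_mono (f := Matrix.mulVecLin
        ((g⁻¹ : GL (Fin n) ℂ) : Matrix (Fin n) (Fin n) ℂ)) hK.le)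
      rw [← map_mul_mulVecLin, inv_mul_cancel, map_one_mulVecLin] at this
      refine lt_of_le_of_ne this fun h => hK.ne ?_
      rw [h, ← map_mul_mulVecLin, mul_inv_cancel, map_one_mulVecLin]
    refine eq_top_iff.mpr fun v _ => ?_
    have h3 : ((g⁻¹ : GL (Fin n) ℂ) : Matrix (Fin n) (Fin n) ℂ) *ᵥ v ∈
      K.map (Matrix.mulVecLin ((g⁻¹ : GL (Fin n) ℂ) : Matrix (Fin n) (Fin n) ℂ)) :=
      h1 h2 ▸ Submodule.mem_top
    rw [mem_map_mulVecLin_iff, Matrix.mulVec_mulVec, ← Units.val_mul, inv_mul_cancel] at h3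
    simpa using h3

theorem IsDefiningForm.act (ha : IsDefiningForm H a) (g : GL (Fin n) ℂ) :
    IsDefiningForm (H.map (Matrix.mulVecLin (g : Matrix (Fin n) (Fin n) ℂ)))
      (ComplexReflection.act g a) :=
  ⟨act_isHomogeneous_one g ha.1, fun v => by rw [mem_map_mulVecLin_iff, ha.2, eval_act]⟩

theorem FixesPointwise.one : FixesPointwise (1 : GL (Fin n) ℂ) H := fun v _ => by simp

theorem FixesPointwise.mul {s t : GL (Fin n) ℂ} (hs : FixesPointwise s H)
    (ht : FixesPointwise t H) : FixesPointwise (s * t) H := fun v hv => by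
  rw [Units.val_mul, ← Matrix.mulVec_mulVec, ht v hv, hs v hv]

theorem FixesPointwise.inv {s : GL (Fin n) ℂ} (hs : FixesPointwise s H) :
    FixesPointwise s⁻¹ H := fun v hv => by
  nth_rewrite 1 [← hs v hv]
  rw [Matrix.mulVec_mulVec, ← Units.val_mul, inv_mul_cancel, Units.val_one, Matrix.one_mulVec]

theorem FixesPointwise.map_eq {s : GL (Fin n) ℂ} (hs : FixesPointwise s H) :
    H.map (Matrix.mulVecLin (s : Matrix (Fin n) (Fin n) ℂ)) = H := by
  ext v
  rw [mem_map_mulVecLin_iff]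
  constructor <;> intro h
  · have := hs _ h
    rw [Matrix.mulVec_mulVec, ← Units.val_mul, mul_inv_cancel, Units.val_one,
      Matrix.one_mulVec] at this
    rwa [this]
  · rwa [hs.inv v h]

theorem FixesPointwise.conj {s : GL (Fin n) ℂ} (hs : FixesPointwise s H) (g : GL (Fin n) ℂ) :
    FixesPointwise (g * s * g⁻¹) (H.map (Matrix.mulVecLin (g : Matrix (Fin n) (Fin n) ℂ))) := by
  intro v hv
  rw [mem_map_mulVecLin_iff] at hv
  rw [Units.val_mul, Units.val_mul, ← Matrix.mulVec_mulVec, ← Matrix.mulVec_mulVec, hs _ hv,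
    Matrix.mulVec_mulVec, ← Units.val_mul, mul_inv_cancel, Units.val_one, Matrix.one_mulVec]

/-- A map that fixes a hyperplane pointwise is `v ↦ v + l(v) u`, where `l` is an equation of the
hyperplane, and its determinant is `1 + l(u)`. -/
theorem FixesPointwise.exists_transvection {s : GL (Fin n) ℂ} (hs : FixesPointwise s H)
    {l : (Fin n → ℂ) →ₗ[ℂ] ℂ} {w : Fin n → ℂ} (hmem : ∀ v, v ∈ H ↔ l v = 0) (hw : l w = 1) :
    ∃ u, (∀ v, (s : Matrix (Fin n) (Fin n) ℂ) *ᵥ v = v + l v • u) ∧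
      (s : Matrix (Fin n) (Fin n) ℂ).det = 1 + l u := by
  have key : ∀ v, (s : Matrix (Fin n) (Fin n) ℂ) *ᵥ v =
      v + l v • ((s : Matrix (Fin n) (Fin n) ℂ) *ᵥ w - w) := by
    intro v
    have h := hs (v - l v • w) ((hmem _).mpr (by simp [hw]))
    rw [Matrix.mulVec_sub, Matrix.mulVec_smul, sub_eq_iff_eq_add] at h
    rw [h, smul_sub]
    abel
  refine ⟨_, key, ?_⟩
  rw [← LinearMap.transvection.det, ← LinearMap.det_toLin']
  congr 1
  refine LinearMap.ext fun v => ?_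
  rw [Matrix.toLin'_apply, key v, LinearMap.transvection.apply]

/-- With `s⁻¹ v = v + l(v) u` one gets `l(s⁻¹ v) = (1 + l(u)) l(v)`, and the factor is `det s⁻¹`. -/
theorem IsDefiningForm.act_of_fixesPointwise (hH : IsCoatom H) (ha : IsDefiningForm H a)
    {s : GL (Fin n) ℂ} (hs : FixesPointwise s H) :
    ComplexReflection.act s a = MvPolynomial.C (Matrix.GeneralLinearGroup.det s)⁻¹.1 * a := by
  obtain ⟨l, w, hl, hmem, hw⟩ := ha.exists_dual hH
  obtain ⟨u, hu, hdet⟩ := hs.inv.exists_transvection hmem hw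
  refine MvPolynomial.funext fun v => ?_
  rw [eval_act, hu, hl, map_mul, hl, MvPolynomial.eval_C, ← map_inv,
    Matrix.GeneralLinearGroup.val_det_apply, hdet, map_add, map_smul, smul_eq_mul]
  ring

/-- A unipotent map of finite order is trivial. -/
theorem FixesPointwise.eq_one_of_det (hH : IsCoatom H) (ha : IsDefiningForm H a)
    {s : GL (Fin n) ℂ} (hs : FixesPointwise s H) (hfin : IsOfFinOrder s)
    (hdet : Matrix.GeneralLinearGroup.det s = 1) : s = 1 := by
  obtain ⟨l, w, hl, hmem, hw⟩ := ha.exists_dual hH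
  obtain ⟨u, hu, hd⟩ := hs.exists_transvection hmem hw
  have hlu : l u = 0 := by
    have := congrArg Units.val hdet
    rw [Matrix.GeneralLinearGroup.val_det_apply, hd] at this
    simpa using this
  obtain ⟨m, hm, hpow⟩ := isOfFinOrder_iff_pow_eq_one.mp hfin
  -- Because `l u = 0`, the translations add up; finite order then gives `m • u = 0` with `m > 0`,
  -- so `u = 0` in characteristic zero.
  have hk : ∀ k : ℕ, ((s ^ k : GL (Fin n) ℂ) : Matrix (Fin n) (Fin n) ℂ) *ᵥ w =
      w + (k : ℂ) • u := by
    intro k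
    induction k with
    | zero => simp
    | succ k ih =>
      rw [pow_succ', Units.val_mul, ← Matrix.mulVec_mulVec, ih, hu, map_add, map_smul, hlu, hw]
      push_cast
      module
  have hu0 : u = 0 := by
    have := hk m
    rw [hpow] at this
    simpa [hm.ne'] using this
  refine Units.ext (Matrix.toLin'.injective (LinearMap.ext fun v => ?_))
  rw [Matrix.toLin'_apply, hu, hu0]
  simp

end DefiningForm

/-! ### Products of defining forms over stable sets of hyperplanes -/

section StableProducts

variable {α : Submodule ℂ (Fin n → ℂ) → PolyRing n} {B : Finset (Submodule ℂ (Fin n → ℂ))}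
  {e : Submodule ℂ (Fin n → ℂ) → ℕ}

theorem prod_ne_zero (hB : ∀ K ∈ B, IsCoatom K ∧ IsDefiningForm K (α K)) :
    ∏ K ∈ B, α K ^ e K ≠ 0 :=
  Finset.prod_ne_zero_iff.mpr fun K hK => pow_ne_zero _ ((hB K hK).2.ne_zero (hB K hK).1)

/-- A stabilising `g` permutes the factors up to nonzero scalars, two equations of one hyperplane
being proportional. -/
theorem exists_act_prod (hB : ∀ K ∈ B, IsCoatom K ∧ IsDefiningForm K (α K)) (g : GL (Fin n) ℂ)
    (hst : ∀ K ∈ B, K.map (Matrix.mulVecLin (g : Matrix (Fin n) (Fin n) ℂ)) ∈ B)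
    (he : ∀ K ∈ B, e (K.map (Matrix.mulVecLin (g : Matrix (Fin n) (Fin n) ℂ))) = e K) :
    ∃ c : ℂ, c ≠ 0 ∧ act g (∏ K ∈ B, α K ^ e K) = MvPolynomial.C c * ∏ K ∈ B, α K ^ e K := by
  classical
  have h1 : ∀ K, ∃ c : ℂ, c ≠ 0 ∧ (K ∈ B → act g (α K) = MvPolynomial.C c *
      α (K.map (Matrix.mulVecLin (g : Matrix (Fin n) (Fin n) ℂ)))) := by
    intro K
    by_cases hK : K ∈ B
    · have h := hB _ (hst K hK)
      obtain ⟨c, hc, hc'⟩ := h.2.eq_C_mul h.1 ((hB K hK).2.act g)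
      exact ⟨c, hc, fun _ => hc'⟩
    · exact ⟨1, one_ne_zero, fun h => absurd h hK⟩
  choose c hc hact using h1
  have himg : B.image (fun K => K.map (Matrix.mulVecLin (g : Matrix (Fin n) (Fin n) ℂ))) = B := by
    refine Finset.eq_of_subset_of_card_le (Finset.image_subset_iff.mpr hst) ?_
    rw [Finset.card_image_of_injective _ (map_mulVecLin_injective g)]
  refine ⟨∏ K ∈ B, c K ^ e K, Finset.prod_ne_zero_iff.mpr fun K _ => pow_ne_zero _ (hc K), ?_⟩
  rw [map_prod, map_prod]
  conv_rhs =>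
    enter [2]
    rw [← himg, Finset.prod_image (map_mulVecLin_injective g).injOn]
  rw [← Finset.prod_mul_distrib]
  refine Finset.prod_congr rfl fun K hK => ?_
  rw [he K hK, map_pow, hact K hK, mul_pow, map_pow]

variable {H : Submodule ℂ (Fin n → ℂ)} {a : PolyRing n} {s : GL (Fin n) ℂ}

/-- The product is multiplied by some scalar. By primality of `a` it does not vanish identically on
`H`, and evaluation at a point of `H`, which `s` fixes, shows that the scalar is `1`. -/
theorem act_prod_of_notMem (hB : ∀ K ∈ B, IsCoatom K ∧ IsDefiningForm K (α K))
    (hst : ∀ K ∈ B, K.map (Matrix.mulVecLin (s : Matrix (Fin n) (Fin n) ℂ)) ∈ B)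
    (he : ∀ K ∈ B, e (K.map (Matrix.mulVecLin (s : Matrix (Fin n) (Fin n) ℂ))) = e K)
    (hH : IsCoatom H) (ha : IsDefiningForm H a) (hs : FixesPointwise s H) (hHB : H ∉ B) :
    act s (∏ K ∈ B, α K ^ e K) = ∏ K ∈ B, α K ^ e K := by
  obtain ⟨c, -, hc⟩ := exists_act_prod hB s hst he
  obtain ⟨v, hv, hv0⟩ : ∃ v ∈ H, MvPolynomial.eval v (∏ K ∈ B, α K ^ e K) ≠ 0 := by
    by_contra! h
    rw [← ha.dvd_iff hH, (ha.prime hH).dvd_finsetProd_iff] at h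
    obtain ⟨K, hK, hdvd⟩ := h
    have := (ha.dvd_iff_eq hH (hB K hK).1 (hB K hK).2).mp ((ha.prime hH).dvd_of_dvd_pow hdvd)
    exact hHB (this ▸ hK)
  have h1 := congrArg (MvPolynomial.eval v) hc
  rw [eval_act, hs.inv v hv, map_mul, MvPolynomial.eval_C] at h1
  rw [hc, (mul_eq_right₀ hv0).mp h1.symm, map_one, one_mul]

theorem act_prod_of_mem (hB : ∀ K ∈ B, IsCoatom K ∧ IsDefiningForm K (α K))
    (hst : ∀ K ∈ B, K.map (Matrix.mulVecLin (s : Matrix (Fin n) (Fin n) ℂ)) ∈ B)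
    (he : ∀ K ∈ B, e (K.map (Matrix.mulVecLin (s : Matrix (Fin n) (Fin n) ℂ))) = e K)
    (hs : FixesPointwise s H) (hHB : H ∈ B) :
    act s (∏ K ∈ B, α K ^ e K) =
      MvPolynomial.C ((Matrix.GeneralLinearGroup.det s)⁻¹.1 ^ e H) * ∏ K ∈ B, α K ^ e K := by
  classical
  obtain ⟨hH, ha⟩ := hB H hHB
  -- Since `s` maps `H` to itself, it also stabilises `B` without `H`, so only the factor at `H`
  -- contributes a scalar.
  have hrest := act_prod_of_notMem (α := α) (B := B.erase H) (e := e)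
    (fun K hK => hB K (Finset.mem_of_mem_erase hK)) (s := s)
    (fun K hK => by
      refine Finset.mem_erase.mpr ⟨fun h => Finset.ne_of_mem_erase hK ?_,
        hst K (Finset.mem_of_mem_erase hK)⟩
      exact map_mulVecLin_injective s (h.trans hs.map_eq.symm))
    (fun K hK => he K (Finset.mem_of_mem_erase hK)) hH ha hs (Finset.notMem_erase H B)
  rw [← Finset.mul_prod_erase B _ hHB, map_mul, hrest, map_pow, ha.act_of_fixesPointwise hH hs,
    mul_pow, map_pow, mul_assoc]

end StableProducts

/-! ### Relative invariants -/

section Isotypic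

variable {G : Subgroup (GL (Fin n) ℂ)} {χ ψ : G →* ℂˣ} {f p : PolyRing n}

theorem mem_isotypic :
    f ∈ isotypic G χ ↔ ∀ g : G, act (g : GL (Fin n) ℂ) f = MvPolynomial.C (χ g : ℂ) * f :=
  Iff.rfl

theorem mem_invariantRing : f ∈ invariantRing G ↔ ∀ g ∈ G, act g f = f := Iff.rfl

theorem mem_isotypic_one : f ∈ isotypic G 1 ↔ f ∈ invariantRing G := by
  rw [mem_isotypic, mem_invariantRing, Subtype.forall]
  simp

theorem mul_mem_isotypic (hf : f ∈ isotypic G χ) (hp : p ∈ isotypic G ψ) :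
    f * p ∈ isotypic G (χ * ψ) := fun g => by
  rw [map_mul, hf g, hp g, MonoidHom.mul_apply, Units.val_mul, map_mul]
  ring

theorem pow_mem_isotypic (hf : f ∈ isotypic G χ) (k : ℕ) : f ^ k ∈ isotypic G (χ ^ k) :=
  fun g => by
    rw [map_pow, hf g, mul_pow, MonoidHom.pow_apply, Units.val_pow_eq_pow_val, map_pow]

theorem mem_isotypic_of_mul_mem (hf0 : f ≠ 0) (hf : f ∈ isotypic G χ)
    (hfp : f * p ∈ isotypic G (χ * ψ)) : p ∈ isotypic G ψ := fun g => by
  have h := hfp g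
  rw [map_mul, hf g, MonoidHom.mul_apply, Units.val_mul, map_mul] at h
  have hc : MvPolynomial.C (χ g : ℂ) * f ≠ 0 :=
    mul_ne_zero (by simp) hf0
  refine mul_left_cancel₀ hc (h.trans ?_)
  ring

theorem exists_character (hf0 : f ≠ 0)
    (hf : ∀ g ∈ G, ∃ c : ℂ, c ≠ 0 ∧ act g f = MvPolynomial.C c * f) :
    ∃ θ : G →* ℂˣ, f ∈ isotypic G θ := by
  choose! c hc0 hc using hf
  have hinj : ∀ x y : ℂ, MvPolynomial.C x * f = MvPolynomial.C y * f → x = y := fun x y h =>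
    MvPolynomial.C_injective _ _ (mul_right_cancel₀ hf0 h)
  refine ⟨{ toFun := fun g => Units.mk0 (c g) (hc0 g g.2), map_one' := ?_, map_mul' := ?_ },
    fun g => hc g g.2⟩
  · refine Units.ext (hinj _ _ ?_)
    rw [Units.val_mk0, ← hc _ (1 : G).2, Subgroup.coe_one, act_one]
    simp
  · intro g h
    refine Units.ext (hinj _ _ ?_)
    rw [Units.val_mul, Units.val_mk0, Units.val_mk0, Units.val_mk0, ← hc _ (g * h).2,
      Subgroup.coe_mul, act_mul, hc h h.2, map_mul, act_C, hc g g.2, map_mul]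
    ring

/-- The elements acting on `f` through `χ` form a subgroup, so a generating set is enough to test.
-/
theorem mem_isotypic_of_reflections (hG : IsReflectionGroup G)
    (h : ∀ s : G, ∀ H ∈ reflectingHyperplanes G, FixesPointwise (s : GL (Fin n) ℂ) H →
      act (s : GL (Fin n) ℂ) f = MvPolynomial.C (χ s : ℂ) * f) :
    f ∈ isotypic G χ := by
  let T : Subgroup G :=
    { carrier := {g | act (g : GL (Fin n) ℂ) f = MvPolynomial.C (χ g : ℂ) * f}
      one_mem' := by simp [act_one]
      mul_mem' := fun {g k} hg hk => by
        rw [Set.mem_ofPred_eq] at hg hk ⊢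
        rw [Subgroup.coe_mul, act_mul, hk, map_mul, act_C, hg, map_mul, Units.val_mul, map_mul]
        ring
      inv_mem' := fun {g} hg => by
        rw [Set.mem_ofPred_eq] at hg ⊢
        have h1 := congrArg (act ((g⁻¹ : G) : GL (Fin n) ℂ)) hg
        rw [← act_mul, ← Subgroup.coe_mul, inv_mul_cancel, Subgroup.coe_one, act_one, map_mul,
          act_C] at h1
        nth_rewrite 2 [h1]
        rw [← mul_assoc, ← map_mul, map_inv, ← Units.val_mul, inv_mul_cancel, Units.val_one,
          map_one, one_mul] }
  have hle : G ≤ T.map G.subtype := by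
    conv_lhs => rw [← hG]
    rw [Subgroup.closure_le]
    rintro s ⟨hsG, hs1, H, hH, hs⟩
    exact ⟨⟨s, hsG⟩, h ⟨s, hsG⟩ H ⟨hH, s, hsG, hs1, hs⟩ hs, rfl⟩
  intro g
  obtain ⟨g', hg', hgg⟩ := hle g.2
  obtain rfl : g' = g := Subtype.ext hgg
  exact hg'

/-- At a point `v` of `H` the relation reads `f(v) = χ(s) f(v)`, so `f` vanishes on `H`. -/
theorem IsDefiningForm.dvd_of_mem_isotypic {H : Submodule ℂ (Fin n → ℂ)} {a : PolyRing n}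
    (hH : IsCoatom H) (ha : IsDefiningForm H a) (hf : f ∈ isotypic G χ) {s : G}
    (hs : FixesPointwise (s : GL (Fin n) ℂ) H) (hχ : χ s ≠ 1) : a ∣ f := by
  rw [ha.dvd_iff hH]
  intro v hv
  have h := congrArg (MvPolynomial.eval v) (hf s)
  rw [eval_act, hs.inv v hv, map_mul, MvPolynomial.eval_C] at h
  by_contra h0
  exact hχ (Units.ext ((mul_eq_right₀ h0).mp h.symm))

/-- Distinct hyperplanes have non-associated prime equations, so the separate divisibilities
multiply. -/
theorem prod_dvd_of_mem_isotypic {α : Submodule ℂ (Fin n → ℂ) → PolyRing n}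
    {B : Finset (Submodule ℂ (Fin n → ℂ))}
    (hB : ∀ K ∈ B, IsCoatom K ∧ IsDefiningForm K (α K)) (hf : f ∈ isotypic G χ)
    (h : ∀ K ∈ B, ∃ s : G, FixesPointwise (s : GL (Fin n) ℂ) K ∧ χ s ≠ 1) :
    ∏ K ∈ B, α K ∣ f := by
  refine Finset.prod_dvd_of_isRelPrime (fun K hK L hL hKL => ?_) fun K hK => ?_
  · obtain ⟨hK1, hK2⟩ := hB K hK
    obtain ⟨hL1, hL2⟩ := hB L hL
    refine (hK2.prime hK1).irreducible.isRelPrime_iff_not_dvd.mpr fun hdvd => hKL ?_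
    exact (hK2.dvd_iff_eq hK1 hL1 hL2).mp hdvd
  · obtain ⟨s, hs, hχ⟩ := h K hK
    exact (hB K hK).2.dvd_of_mem_isotypic (hB K hK).1 hf hs hχ

end Isotypic

/-! ### The Reynolds operators -/

section Reynolds

variable {G : Subgroup (GL (Fin n) ℂ)}

theorem act_invariant_smul (g : G) (r : invariantRing G) (f : PolyRing n) :
    act (g : GL (Fin n) ℂ) (r • f) = r • act (g : GL (Fin n) ℂ) f := by
  have hr : act (g : GL (Fin n) ℂ) (r : PolyRing n) = r := r.2 g g.2
  rw [Subring.smul_def, smul_eq_mul, map_mul, hr, Subring.smul_def, smul_eq_mul]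

variable [Fintype G]

/-- The `R`-linear projection of `S` on the isotypical component of a linear character. -/
noncomputable def reynolds (χ : G →* ℂˣ) : PolyRing n →ₗ[invariantRing G] isotypic G χ where
  toFun f := ⟨MvPolynomial.C (Fintype.card G : ℂ)⁻¹ *
      ∑ g : G, MvPolynomial.C (χ g : ℂ)⁻¹ * act (g : GL (Fin n) ℂ) f, fun h => by
    rw [map_mul, act_C, map_sum, mul_left_comm]
    congr 1
    rw [Finset.mul_sum]
    refine Fintype.sum_equiv (Equiv.mulLeft h) _ _ fun g => ?_
    rw [Equiv.coe_mulLeft, map_mul, act_C, Subgroup.coe_mul, act_mul, ← mul_assoc, ← map_mul,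
      map_mul χ, Units.val_mul, mul_inv, mul_inv_cancel_left₀ (Units.ne_zero _)]⟩
  map_add' f p := Subtype.ext <| by
    simp only [map_add, mul_add, Finset.sum_add_distrib, Submodule.coe_add]
  map_smul' r f := Subtype.ext <| by
    simp only [act_invariant_smul, mul_smul_comm, ← Finset.smul_sum, RingHom.id_apply,
      Submodule.coe_smul]

theorem reynolds_apply (χ : G →* ℂˣ) (f : PolyRing n) :
    (reynolds χ f : PolyRing n) = MvPolynomial.C (Fintype.card G : ℂ)⁻¹ *
      ∑ g : G, MvPolynomial.C (χ g : ℂ)⁻¹ * act (g : GL (Fin n) ℂ) f := rfl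

theorem reynolds_of_mem {χ : G →* ℂˣ} (f : isotypic G χ) : reynolds χ (f : PolyRing n) = f := by
  refine Subtype.ext ?_
  rw [reynolds_apply, Finset.sum_congr rfl fun g _ => by
    rw [f.2 g, ← mul_assoc, ← map_mul, inv_mul_cancel₀ (Units.ne_zero _), map_one, one_mul]]
  rw [Finset.sum_const, Finset.card_univ, nsmul_eq_mul, ← mul_assoc, ← map_natCast
    (MvPolynomial.C : ℂ →+* PolyRing n), ← map_mul, inv_mul_cancel₀, map_one, one_mul]
  exact_mod_cast Fintype.card_ne_zero

/-- The scalar `ψ g` by which `g` acts on `z` cancels the extra factor `(ψ g)⁻¹` in the average.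
This lets the projection descend to `S/(z)`. -/
theorem reynolds_mul {χ ψ : G →* ℂˣ} {z : PolyRing n} (hz : z ∈ isotypic G ψ) (f : PolyRing n) :
    (reynolds (χ * ψ) (z * f) : PolyRing n) = z * reynolds χ f := by
  rw [reynolds_apply, reynolds_apply, mul_left_comm]
  congr 1
  rw [Finset.mul_sum]
  refine Finset.sum_congr rfl fun g _ => ?_
  have h : (MvPolynomial.C (ψ g : ℂ)⁻¹ : PolyRing n) * MvPolynomial.C (ψ g : ℂ) = 1 := by
    rw [← map_mul, inv_mul_cancel₀ (Units.ne_zero _), map_one]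
  rw [map_mul, hz g, MonoidHom.mul_apply, Units.val_mul, mul_inv, map_mul]
  linear_combination (MvPolynomial.C (χ g : ℂ)⁻¹ * z * act (g : GL (Fin n) ℂ) f) * h

end Reynolds

/-! ### Pointwise fixers of hyperplanes -/

section Fixer

variable (G : Subgroup (GL (Fin n) ℂ)) (H : Submodule ℂ (Fin n → ℂ))

/-- The pointwise fixer in `G` of a subspace. -/
def fixer : Subgroup (GL (Fin n) ℂ) where
  carrier := {g | g ∈ G ∧ FixesPointwise g H}
  one_mem' := ⟨G.one_mem, FixesPointwise.one⟩
  mul_mem' := fun hg hh => ⟨G.mul_mem hg.1 hh.1, hg.2.mul hh.2⟩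
  inv_mem' := fun hg => ⟨G.inv_mem hg.1, hg.2.inv⟩

theorem card_fixer : Nat.card (fixer G H) = fixerOrder G H := rfl

variable {G H}

theorem fixerOrder_map {g : GL (Fin n) ℂ} (hg : g ∈ G) :
    fixerOrder G (H.map (Matrix.mulVecLin (g : Matrix (Fin n) (Fin n) ℂ))) = fixerOrder G H := by
  refine (Nat.card_congr (Equiv.subtypeEquiv (MulAut.conj g).toEquiv fun s => ?_)).symm
  simp only [MulEquiv.toEquiv_eq_coe, EquivLike.coe_coe, MulAut.conj_apply]
  constructor
  · rintro ⟨h1, h2⟩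
    exact ⟨G.mul_mem (G.mul_mem hg h1) (G.inv_mem hg), h2.conj g⟩
  · rintro ⟨h1, h2⟩
    have h3 := G.mul_mem (G.mul_mem (G.inv_mem hg) h1) hg
    have h4 := h2.conj g⁻¹
    rw [← map_mul_mulVecLin, inv_mul_cancel, map_one_mulVecLin] at h4
    simp only [mul_assoc, inv_mul_cancel_left, inv_mul_cancel, mul_one, inv_inv] at h3 h4
    exact ⟨h3, h4⟩

theorem pow_fixerOrder {s : GL (Fin n) ℂ} (hsG : s ∈ G) (hs : FixesPointwise s H) :
    s ^ fixerOrder G H = 1 := by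
  have h := pow_card_eq_one' (x := (⟨s, hsG, hs⟩ : fixer G H))
  rw [card_fixer] at h
  simpa using congrArg Subtype.val h

variable [Finite G]

instance : Finite (fixer G H) :=
  Finite.of_injective (Subgroup.inclusion (fun _ hg => hg.1 : fixer G H ≤ G))
    (Subgroup.inclusion_injective _)

theorem fixerOrder_pos : 0 < fixerOrder G H := by
  rw [← card_fixer]
  exact Nat.card_pos

theorem IsDefiningForm.eq_one_of_det {a : PolyRing n} (hH : IsCoatom H) (ha : IsDefiningForm H a)
    {s : GL (Fin n) ℂ} (hsG : s ∈ G) (hs : FixesPointwise s H)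
    (hdet : Matrix.GeneralLinearGroup.det s = 1) : s = 1 :=
  hs.eq_one_of_det hH ha
    (isOfFinOrder_iff_pow_eq_one.mpr ⟨_, fixerOrder_pos, pow_fixerOrder hsG hs⟩) hdet

/-- Otherwise the determinant would embed the fixer into the `k`-th roots of unity, of which there
are at most `k`, fewer than the order of the fixer. -/
theorem IsDefiningForm.exists_det_pow_ne_one {a : PolyRing n} (hH : IsCoatom H)
    (ha : IsDefiningForm H a) {k : ℕ} (hk : 0 < k) (hkH : k < fixerOrder G H) :
    ∃ s ∈ G, FixesPointwise s H ∧ Matrix.GeneralLinearGroup.det s ^ k ≠ 1 := by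
  by_contra! h
  have : NeZero k := ⟨hk.ne'⟩
  let d : fixer G H → rootsOfUnity k ℂ := fun s =>
    ⟨Matrix.GeneralLinearGroup.det s.1, (mem_rootsOfUnity _ _).mpr (h s s.2.1 s.2.2)⟩
  have hd : Function.Injective d := by
    intro s t hst
    have h1 : Matrix.GeneralLinearGroup.det s.1 = Matrix.GeneralLinearGroup.det t.1 :=
      congrArg Subtype.val hst
    have h2 : s.1 * t.1⁻¹ = 1 := ha.eq_one_of_det hH (s * t⁻¹).2.1 (s * t⁻¹).2.2 (by
      rw [map_mul, map_inv, h1, mul_inv_cancel])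
    exact Subtype.ext (mul_inv_eq_one.mp h2)
  have := (Nat.card_le_card_of_injective d hd).trans (card_rootsOfUnity ℂ k)
  rw [card_fixer] at this
  omega

end Fixer

/-! ### Direct summands and quotients of the ring of scalars -/

section Modules

theorem exists_isCompl_of_retraction {A M N : Type*} [Ring A] [AddCommGroup M] [Module A M]
    [AddCommGroup N] [Module A N] (i : M →ₗ[A] N) (r : N →ₗ[A] M) (h : ∀ x, r (i x) = x) :
    ∃ (P Q : Submodule A N) (φ : M ≃ₗ[A] P), IsCompl P Q ∧ ∀ x, (φ x : N) = i x := by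
  have hi : Function.Injective i := Function.LeftInverse.injective h
  refine ⟨LinearMap.range i, LinearMap.ker (i.rangeRestrict ∘ₗ r), LinearEquiv.ofInjective i hi,
    LinearMap.isCompl_of_proj ?_, fun x => rfl⟩
  rintro ⟨_, x, rfl⟩
  exact Subtype.ext (congrArg i (h x))

theorem exists_lift_of_surjective {A M N L : Type*} [Ring A] [AddCommGroup M] [Module A M]
    [AddCommGroup N] [Module A N] [AddCommGroup L] [Module A L] (π : M →ₗ[A] N)
    (hπ : Function.Surjective π) (f : M →ₗ[A] L) (h : ∀ x, π x = 0 → f x = 0) :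
    ∃ r : N →ₗ[A] L, ∀ x, r (π x) = f x := by
  refine ⟨(LinearMap.ker π).liftQ f h ∘ₗ (π.quotKerEquivOfSurjective hπ).symm.toLinearMap,
    fun x => ?_⟩
  have : (π.quotKerEquivOfSurjective hπ).symm (π x) = Submodule.Quotient.mk x := by
    rw [LinearEquiv.symm_apply_eq]
    rfl
  rw [LinearMap.comp_apply, LinearEquiv.coe_coe, this]
  rfl

variable {A M N : Type*} [CommRing A] {I : Ideal A} [AddCommGroup M] [Module A M]
  [AddCommGroup N] [Module A N]

/-- A linear map between modules annihilated by an ideal is linear over the quotient ring. -/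
def quotientScalars (hM : Module.IsTorsionBySet A M I) (hN : Module.IsTorsionBySet A N I)
    (f : M →ₗ[A] N) :
    letI := hM.module
    letI := hN.module
    M →ₗ[A ⧸ I] N :=
  letI := hM.module
  letI := hN.module
  { f with
    map_smul' := fun c x => by
      obtain ⟨c, rfl⟩ := Ideal.Quotient.mk_surjective c
      exact f.map_smul c x }

/-- A linear isomorphism between modules annihilated by an ideal is linear over the quotient
ring. -/
def quotientScalarsEquiv (hM : Module.IsTorsionBySet A M I) (hN : Module.IsTorsionBySet A N I)
    (f : M ≃ₗ[A] N) :
    letI := hM.module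
    letI := hN.module
    M ≃ₗ[A ⧸ I] N :=
  letI := hM.module
  letI := hN.module
  { quotientScalars hM hN f.toLinearMap with
    invFun := f.symm
    left_inv := f.left_inv
    right_inv := f.right_inv }

end Modules

/-! ### The cokernel of multiplication between free isotypical components -/

section Cokernel

variable {G : Subgroup (GL (Fin n) ℂ)} {χ ψ : G →* ℂˣ} {z u y : PolyRing n} {D : invariantRing G}

theorem exists_smul_eq_of_dvd (hu0 : u ≠ 0) (hu : u ∈ isotypic G χ) {f : PolyRing n}
    (hf : f ∈ isotypic G χ) (h : u ∣ f) : ∃ r : invariantRing G, r • u = f := by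
  obtain ⟨q, rfl⟩ := h
  have hq : q ∈ isotypic G 1 := mem_isotypic_of_mul_mem hu0 hu ((mul_one χ).symm ▸ hf)
  exact ⟨⟨q, mem_isotypic_one.mp hq⟩, by rw [Subring.smul_def, smul_eq_mul, mul_comm]⟩

/-- If the isotypical components of `χ` and `ψ` are generated by `u` and `y` and `z u = D y`, then
the cokernel of multiplication by `z` is `R/(D)`. -/
theorem nonempty_cokerMul_equiv (hz : ∀ f ∈ isotypic G χ, z * f ∈ isotypic G ψ)
    (hu0 : u ≠ 0) (hu : u ∈ isotypic G χ) (hu' : ∀ f ∈ isotypic G χ, u ∣ f)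
    (hy0 : y ≠ 0) (hy : y ∈ isotypic G ψ) (hy' : ∀ f ∈ isotypic G ψ, y ∣ f)
    (hD : z * u = D * y) :
    Nonempty (CokerMul G z χ ψ hz ≃ₗ[invariantRing G] invariantRing G ⧸ Ideal.span {D}) := by
  let m : invariantRing G →ₗ[invariantRing G] CokerMul G z χ ψ hz :=
    (Submodule.mkQ _) ∘ₗ (LinearMap.toSpanSingleton (invariantRing G) (isotypic G ψ) ⟨y, hy⟩)
  have hm : Function.Surjective m := by
    intro x
    obtain ⟨⟨f, hf⟩, rfl⟩ := Submodule.mkQ_surjective _ x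
    obtain ⟨r, hr⟩ := exists_smul_eq_of_dvd hy0 hy hf (hy' f hf)
    exact ⟨r, congrArg (Submodule.mkQ _) (Subtype.ext hr)⟩
  -- `r y` lies in the image iff `r y = z q u = q D y` for some `q` in `R`; cancelling `y` in the
  -- domain `S` gives `r = D q`.
  have hker : LinearMap.ker m = Ideal.span {D} := by
    ext r
    rw [LinearMap.mem_ker, Ideal.mem_span_singleton, LinearMap.comp_apply, Submodule.mkQ_apply,
      Submodule.Quotient.mk_eq_zero, LinearMap.mem_range]
    constructor
    · rintro ⟨⟨f, hf⟩, hfr⟩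
      obtain ⟨q, rfl⟩ := exists_smul_eq_of_dvd hu0 hu hf (hu' f hf)
      refine ⟨q, Subtype.ext (mul_right_cancel₀ hy0 ?_)⟩
      have h1 : z * ((q : PolyRing n) * u) = r * y := congrArg Subtype.val hfr
      rw [Subring.coe_mul]
      linear_combination (q : PolyRing n) * hD - h1
    · rintro ⟨q, rfl⟩
      refine ⟨q • ⟨u, hu⟩, Subtype.ext ?_⟩
      change z * ((q : PolyRing n) * u) = ((D * q : invariantRing G) : PolyRing n) * y
      rw [Subring.coe_mul]
      linear_combination (q : PolyRing n) * hD
  exact ⟨((Submodule.quotEquivOfEq _ _ hker).symm.trans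
    (m.quotKerEquivOfSurjective hm)).symm⟩

/-- The map from the cokernel of multiplication by a relative invariant `z` to `S/(z)` has a
retraction. -/
theorem exists_cokerMul_retraction [Finite G] (hz : z ∈ isotypic G ψ)
    (hz' : ∀ f ∈ isotypic G χ, z * f ∈ isotypic G (χ * ψ)) :
    ∃ (i : CokerMul G z χ (χ * ψ) hz' →ₗ[invariantRing G] PolyRing n ⧸ Ideal.span {z})
      (r : (PolyRing n ⧸ Ideal.span {z}) →ₗ[invariantRing G] CokerMul G z χ (χ * ψ) hz'),
      (∀ x, r (i x) = x) ∧
      ∀ f : isotypic G (χ * ψ), i (Submodule.Quotient.mk f) =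
        Ideal.Quotient.mk (Ideal.span {z}) (f : PolyRing n) := by
  cases nonempty_fintype G
  let π : PolyRing n →ₗ[invariantRing G] PolyRing n ⧸ Ideal.span {z} :=
    { toFun := Ideal.Quotient.mk (Ideal.span {z})
      map_add' := map_add _
      map_smul' := fun _ _ => rfl }
  have hπ0 : ∀ f, π f = 0 ↔ z ∣ f := fun f =>
    Ideal.Quotient.eq_zero_iff_mem.trans Ideal.mem_span_singleton
  -- The projection sends `z q` to `z` times the `χ`-component of `q`, which is zero in the
  -- cokernel.
  obtain ⟨r, hr⟩ := exists_lift_of_surjective π Ideal.Quotient.mk_surjective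
    (Submodule.mkQ (LinearMap.range (mulRestrict G z χ (χ * ψ) hz')) ∘ₗ reynolds (χ * ψ))
    (fun f hf => by
      obtain ⟨q, rfl⟩ := (hπ0 f).mp hf
      rw [LinearMap.comp_apply, Submodule.mkQ_apply, Submodule.Quotient.mk_eq_zero]
      exact ⟨reynolds χ q, Subtype.ext (reynolds_mul hz q).symm⟩)
  let i : CokerMul G z χ (χ * ψ) hz' →ₗ[invariantRing G] PolyRing n ⧸ Ideal.span {z} :=
    Submodule.liftQ _ (π ∘ₗ (isotypic G (χ * ψ)).subtype) (by
      rintro _ ⟨f, rfl⟩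
      exact (hπ0 _).mpr (dvd_mul_right z (f : PolyRing n)))
  refine ⟨i, r, fun x => ?_, fun f => rfl⟩
  obtain ⟨f, rfl⟩ := Submodule.mkQ_surjective _ x
  change r (π f) = _
  rw [hr, LinearMap.comp_apply, reynolds_of_mem]

end Cokernel

/-! ### Orbits of reflecting hyperplanes -/

section Orbits

variable {G : Subgroup (GL (Fin n) ℂ)} {H K : Submodule ℂ (Fin n → ℂ)}
  {O : Set (Submodule ℂ (Fin n → ℂ))}

theorem map_mem_reflectingHyperplanes (hH : H ∈ reflectingHyperplanes G) {g : GL (Fin n) ℂ}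
    (hg : g ∈ G) :
    H.map (Matrix.mulVecLin (g : Matrix (Fin n) (Fin n) ℂ)) ∈ reflectingHyperplanes G := by
  obtain ⟨hc, s, hs, hs1, hf⟩ := hH
  exact ⟨isCoatom_map hc g, g * s * g⁻¹, G.mul_mem (G.mul_mem hg hs) (G.inv_mem hg),
    fun h => hs1 (conj_eq_one_iff.mp h), hf.conj g⟩

theorem subset_reflectingHyperplanes (hO : O ∈ hyperplaneOrbits G) :
    O ⊆ reflectingHyperplanes G := by
  obtain ⟨H, hH, rfl⟩ := hO
  rintro _ ⟨g, hg, rfl⟩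
  exact map_mem_reflectingHyperplanes hH hg

theorem map_mem_orbit (hO : O ∈ hyperplaneOrbits G) (hK : K ∈ O) {g : GL (Fin n) ℂ}
    (hg : g ∈ G) : K.map (Matrix.mulVecLin (g : Matrix (Fin n) (Fin n) ℂ)) ∈ O := by
  obtain ⟨H, hH, rfl⟩ := hO
  obtain ⟨h, hh, rfl⟩ := hK
  exact ⟨g * h, G.mul_mem hg hh, (map_mul_mulVecLin g h).symm⟩

theorem mem_orbit_of_map_mem (hO : O ∈ hyperplaneOrbits G) {g : GL (Fin n) ℂ} (hg : g ∈ G)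
    (hK : K.map (Matrix.mulVecLin (g : Matrix (Fin n) (Fin n) ℂ)) ∈ O) : K ∈ O := by
  have h := map_mem_orbit hO hK (G.inv_mem hg)
  rwa [← map_mul_mulVecLin, inv_mul_cancel, map_one_mulVecLin] at h

theorem fixerOrder_eq_of_mem_orbit (hO : O ∈ hyperplaneOrbits G) (hH : H ∈ O) (hK : K ∈ O) :
    fixerOrder G H = fixerOrder G K := by
  obtain ⟨L, hL, rfl⟩ := hO
  obtain ⟨g, hg, rfl⟩ := hH
  obtain ⟨h, hh, rfl⟩ := hK
  rw [fixerOrder_map hg, fixerOrder_map hh]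

theorem nonempty_of_mem_hyperplaneOrbits (hO : O ∈ hyperplaneOrbits G) : O.Nonempty := by
  obtain ⟨L, hL, rfl⟩ := hO
  exact ⟨L, 1, G.one_mem, map_one_mulVecLin.symm⟩

end Orbits

/-! ### Characters and generators attached to stable sets of reflecting hyperplanes -/

section StableSubsets

variable {G : Subgroup (GL (Fin n) ℂ)} {α : Submodule ℂ (Fin n → ℂ) → PolyRing n}
  {B : Finset (Submodule ℂ (Fin n → ℂ))} {H : Submodule ℂ (Fin n → ℂ)}

variable (G α B) in
/-- A `G`-stable finite set of reflecting hyperplanes, with chosen equations. -/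
structure IsStableArrangement : Prop where
  subset : ∀ K ∈ B, K ∈ reflectingHyperplanes G
  form : ∀ K ∈ B, IsDefiningForm K (α K)
  stable : ∀ g ∈ G, ∀ K ∈ B, K.map (Matrix.mulVecLin (g : Matrix (Fin n) (Fin n) ℂ)) ∈ B

theorem IsStableArrangement.coatom_form (hB : IsStableArrangement G α B) :
    ∀ K ∈ B, IsCoatom K ∧ IsDefiningForm K (α K) :=
  fun K hK => ⟨(hB.subset K hK).1, hB.form K hK⟩

theorem IsStableArrangement.prod_ne_zero (hB : IsStableArrangement G α B) :
    ∏ K ∈ B, α K ≠ 0 := by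
  simpa using ComplexReflection.prod_ne_zero (e := fun _ => 1) hB.coatom_form

theorem IsStableArrangement.act_prod_of_mem (hB : IsStableArrangement G α B) {s : GL (Fin n) ℂ}
    (hsG : s ∈ G) (hs : FixesPointwise s H) (hH : H ∈ B) :
    act s (∏ K ∈ B, α K) =
      MvPolynomial.C (Matrix.GeneralLinearGroup.det s)⁻¹.1 * ∏ K ∈ B, α K := by
  simpa using ComplexReflection.act_prod_of_mem (e := fun _ => 1) hB.coatom_form (hB.stable s hsG)
    (fun _ _ => rfl) hs hH

theorem IsStableArrangement.act_prod_of_notMem (hB : IsStableArrangement G α B)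
    {s : GL (Fin n) ℂ} (hsG : s ∈ G) (hs : FixesPointwise s H) (hH : IsCoatom H)
    {a : PolyRing n} (ha : IsDefiningForm H a) (hHB : H ∉ B) :
    act s (∏ K ∈ B, α K) = ∏ K ∈ B, α K := by
  simpa using ComplexReflection.act_prod_of_notMem (e := fun _ => 1) hB.coatom_form
    (hB.stable s hsG) (fun _ _ => rfl) hH ha hs hHB

theorem IsStableArrangement.exists_character (hB : IsStableArrangement G α B) :
    ∃ θ : G →* ℂˣ, ∏ K ∈ B, α K ∈ isotypic G θ := by
  refine ComplexReflection.exists_character hB.prod_ne_zero fun g hg => ?_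
  simpa using exists_act_prod (e := fun _ => 1) hB.coatom_form g (hB.stable g hg) fun _ _ => rfl

/-- A fixer of `H` in `B` scales the product by `(det s)⁻¹ ^ e_H = 1`, and the other fixers leave it
unchanged. Any stable set is allowed: the result serves for all hyperplanes, for the orbit and for
its complement. -/
theorem IsStableArrangement.prod_pow_mem_invariantRing [Finite G] (hG : IsReflectionGroup G)
    (hα : ∀ H ∈ reflectingHyperplanes G, IsDefiningForm H (α H))
    (hB : IsStableArrangement G α B) : ∏ K ∈ B, α K ^ fixerOrder G K ∈ invariantRing G := by
  rw [← mem_isotypic_one]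
  refine mem_isotypic_of_reflections hG fun s H hH hs => ?_
  have he : ∀ K ∈ B, fixerOrder G (K.map (Matrix.mulVecLin
      ((s : GL (Fin n) ℂ) : Matrix (Fin n) (Fin n) ℂ))) = fixerOrder G K :=
    fun K _ => fixerOrder_map s.2
  rw [MonoidHom.one_apply, Units.val_one, map_one, one_mul]
  by_cases hHB : H ∈ B
  · rw [ComplexReflection.act_prod_of_mem hB.coatom_form (hB.stable s s.2) he hs hHB,
      ← Units.val_pow_eq_pow_val, ← map_inv, ← map_pow, inv_pow, pow_fixerOrder s.2 hs]
    simp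
  · exact ComplexReflection.act_prod_of_notMem hB.coatom_form (hB.stable s s.2) he hH.1
      (hα H hH) hs hHB

theorem coe_character_eq {f : PolyRing n} {χ : G →* ℂˣ} (hf0 : f ≠ 0) (hf : f ∈ isotypic G χ)
    {s : G} {c : ℂˣ} (h : act (s : GL (Fin n) ℂ) f = MvPolynomial.C c.1 * f) : χ s = c :=
  Units.ext (MvPolynomial.C_injective _ _ (mul_right_cancel₀ hf0 ((hf s).symm.trans h)))

theorem IsStableArrangement.character_of_mem (hB : IsStableArrangement G α B) {θ : G →* ℂˣ}
    (hθ : ∏ K ∈ B, α K ∈ isotypic G θ) {s : G} (hs : FixesPointwise (s : GL (Fin n) ℂ) H)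
    (hH : H ∈ B) : θ s = detChar G s :=
  coe_character_eq hB.prod_ne_zero hθ (hB.act_prod_of_mem s.2 hs hH)

theorem IsStableArrangement.character_of_notMem (hB : IsStableArrangement G α B) {θ : G →* ℂˣ}
    (hα : ∀ H ∈ reflectingHyperplanes G, IsDefiningForm H (α H))
    (hθ : ∏ K ∈ B, α K ∈ isotypic G θ) {s : G} (hs : FixesPointwise (s : GL (Fin n) ℂ) H)
    (hH : H ∈ reflectingHyperplanes G) (hHB : H ∉ B) : θ s = 1 := by
  refine coe_character_eq hB.prod_ne_zero hθ ?_
  rw [hB.act_prod_of_notMem s.2 hs hH.1 (hα H hH) hHB]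
  simp

theorem detChar_pow_fixerOrder {s : G} (hs : FixesPointwise (s : GL (Fin n) ℂ) H) :
    detChar G s ^ fixerOrder G H = 1 := by
  change ((Matrix.GeneralLinearGroup.det (s : GL (Fin n) ℂ))⁻¹) ^ fixerOrder G H = 1
  rw [← map_inv, ← map_pow, inv_pow, pow_fixerOrder s.2 hs, inv_one, map_one]

theorem exists_detChar_pow_ne_one [Finite G] {a : PolyRing n} (hH : IsCoatom H)
    (ha : IsDefiningForm H a) {k : ℕ} (hk : 0 < k) (hkH : k < fixerOrder G H) :
    ∃ s : G, FixesPointwise (s : GL (Fin n) ℂ) H ∧ detChar G s ^ k ≠ 1 := by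
  obtain ⟨s, hsG, hs, hdet⟩ := ha.exists_det_pow_ne_one hH hk hkH
  refine ⟨⟨s, hsG⟩, hs, fun h => hdet ?_⟩
  change ((Matrix.GeneralLinearGroup.det s)⁻¹) ^ k = 1 at h
  rwa [inv_pow, inv_eq_one] at h

theorem one_lt_fixerOrder [Finite G] (hH : H ∈ reflectingHyperplanes G) :
    1 < fixerOrder G H := by
  obtain ⟨-, s, hsG, hs1, hs⟩ := hH
  rw [← card_fixer, Finite.one_lt_card_iff_nontrivial]
  exact ⟨⟨s, hsG, hs⟩, 1, fun h => hs1 (congrArg Subtype.val h)⟩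

/-- The isotypical components of the first powers of the character of an orbit. -/
theorem IsStableArrangement.prod_pow_dvd [Finite G] (hB : IsStableArrangement G α B)
    {θ : G →* ℂˣ} (hθ : ∏ K ∈ B, α K ∈ isotypic G θ) {k : ℕ}
    (hk : ∀ K ∈ B, k < fixerOrder G K) {f : PolyRing n} (hf : f ∈ isotypic G (θ ^ k)) :
    (∏ K ∈ B, α K) ^ k ∣ f := by
  induction k generalizing f with
  | zero => simp
  | succ k ih =>
    -- On the fixer of `K` the character is `detChar ^ (k + 1)`, which is nontrivial because `k + 1
    -- < e_K`. The quotient `q` then belongs to `θ ^ k`.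
    obtain ⟨q, rfl⟩ : ∏ K ∈ B, α K ∣ f := by
      refine prod_dvd_of_mem_isotypic hB.coatom_form hf fun K hK => ?_
      obtain ⟨s, hs, h⟩ := exists_detChar_pow_ne_one (hB.subset K hK).1 (hB.form K hK)
        k.succ_pos (hk K hK)
      exact ⟨s, hs, by rwa [MonoidHom.pow_apply, hB.character_of_mem hθ hs hK]⟩
    rw [pow_succ' θ] at hf
    rw [pow_succ']
    exact mul_dvd_mul_left _ (ih (fun K hK => (Nat.lt_succ_self k).trans (hk K hK))
      (mem_isotypic_of_mul_mem hB.prod_ne_zero hθ hf))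

/-- The product of the equations of all reflecting hyperplanes is a relative invariant for the
determinant of the dual representation. -/
theorem IsStableArrangement.prod_mem_isotypic_detChar (hG : IsReflectionGroup G)
    (hB : IsStableArrangement G α B) (hall : ∀ H ∈ reflectingHyperplanes G, H ∈ B) :
    ∏ K ∈ B, α K ∈ isotypic G (detChar G) :=
  mem_isotypic_of_reflections hG fun s H hH hs => hB.act_prod_of_mem s.2 hs (hall H hH)

variable {C : Finset (Submodule ℂ (Fin n → ℂ))} {θ : G →* ℂˣ} {e : ℕ}

/-- The exponent `e - 1` is chosen so that on fixers of hyperplanes in `B` the character becomes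
`detChar ^ e = 1`; off `B`, `θ` is trivial and `detChar` remains. The product over the complement
behaves in just this way. -/
theorem IsStableArrangement.prod_compl_mem (hG : IsReflectionGroup G)
    (hα : ∀ H ∈ reflectingHyperplanes G, IsDefiningForm H (α H))
    (hB : IsStableArrangement G α B) (hC : IsStableArrangement G α C)
    (hBC : ∀ H ∈ reflectingHyperplanes G, H ∈ C ↔ H ∉ B)
    (hθ : ∏ K ∈ B, α K ∈ isotypic G θ) (he0 : 0 < e) (he : ∀ K ∈ B, fixerOrder G K = e) :
    ∏ K ∈ C, α K ∈ isotypic G (θ ^ (e - 1) * detChar G) := by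
  refine mem_isotypic_of_reflections hG fun s H hH hs => ?_
  rw [MonoidHom.mul_apply, MonoidHom.pow_apply]
  by_cases hHB : H ∈ B
  · rw [hC.act_prod_of_notMem s.2 hs hH.1 (hα H hH) (fun h => (hBC H hH).mp h hHB),
      hB.character_of_mem hθ hs hHB, ← pow_succ, Nat.sub_add_cancel he0, ← he H hHB,
      detChar_pow_fixerOrder hs]
    simp
  · rw [hB.character_of_notMem hα hθ hs hH hHB, one_pow, one_mul]
    exact hC.act_prod_of_mem s.2 hs ((hBC H hH).mpr hHB)

/-- On fixers of hyperplanes in `C` only `detChar` survives, and it is nontrivial there since each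
such fixer is nontrivial. -/
theorem IsStableArrangement.prod_compl_dvd [Finite G]
    (hα : ∀ H ∈ reflectingHyperplanes G, IsDefiningForm H (α H))
    (hB : IsStableArrangement G α B) (hC : IsStableArrangement G α C)
    (hBC : ∀ H ∈ reflectingHyperplanes G, H ∈ C ↔ H ∉ B)
    (hθ : ∏ K ∈ B, α K ∈ isotypic G θ) {f : PolyRing n}
    (hf : f ∈ isotypic G (θ ^ (e - 1) * detChar G)) : ∏ K ∈ C, α K ∣ f := by
  refine prod_dvd_of_mem_isotypic hC.coatom_form hf fun K hK => ?_
  have hKA := hC.subset K hK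
  obtain ⟨s, hs, h⟩ := exists_detChar_pow_ne_one hKA.1 (hC.form K hK) zero_lt_one
    (one_lt_fixerOrder hKA)
  refine ⟨s, hs, ?_⟩
  rwa [MonoidHom.mul_apply, MonoidHom.pow_apply,
    hB.character_of_notMem hα hθ hs hKA ((hBC K hKA).mp hK), one_pow, one_mul, ← pow_one
    (detChar G s)]

end StableSubsets

theorem isTorsionBySet_span_singleton {A M : Type*} [CommRing A] [AddCommGroup M] [Module A M]
    {d : A} (h : ∀ x : M, d • x = 0) :
    Module.IsTorsionBySet A M (Ideal.span {d} : Ideal A) :=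
  (Module.isTorsionBySet_span_singleton_iff d).mpr fun x => h x

end ComplexReflection

theorem mainTheorem9 {n : ℕ} (G : Subgroup (GL (Fin n) ℂ)) [Finite G]
    (hG : IsReflectionGroup G)
    (α : Submodule ℂ (Fin n → ℂ) → PolyRing n)
    (hα : ∀ H ∈ reflectingHyperplanes G, IsDefiningForm H (α H))
    (z : PolyRing n) (hz : z = ∏ᶠ H ∈ reflectingHyperplanes G, α H)
    (O : Set (Submodule ℂ (Fin n → ℂ))) (hO : O ∈ hyperplaneOrbits G) :
    -- the discriminant and its factor belonging to the orbit lie in the invariant ring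
    ∃ Δ ΔO : invariantRing G,
      (Δ : PolyRing n) = ∏ᶠ H ∈ reflectingHyperplanes G, α H ^ fixerOrder G H ∧
      (ΔO : PolyRing n) = ∏ᶠ H ∈ O, α H ^ fixerOrder G H ∧
    -- `S/(z)` and `R/(ΔO)` are modules over `R/(Δ)`
    ∃ (tS : Module.IsTorsionBySet (invariantRing G) (PolyRing n ⧸ Ideal.span {z})
          (Ideal.span {Δ} : Ideal (invariantRing G)))
      (tO : Module.IsTorsionBySet (invariantRing G) (invariantRing G ⧸ Ideal.span {ΔO})
          (Ideal.span {Δ} : Ideal (invariantRing G))),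
      letI := tS.module
      letI := tO.module
      IsDirectSummand (invariantRing G ⧸ Ideal.span {Δ})
        (invariantRing G ⧸ Ideal.span {ΔO}) (PolyRing n ⧸ Ideal.span {z}) ∧
    -- the linear character of the orbit
    ∃ θ : G →* ℂˣ,
      (∀ g : G, act (g : GL (Fin n) ℂ) (∏ᶠ H ∈ O, α H) =
        MvPolynomial.C (θ g : ℂ) * ∏ᶠ H ∈ O, α H) ∧
    -- the summand is the cokernel of `z` on the isotypical component of `θ ^ (e_H - 1)`
    ∀ H ∈ O,
      ∃ (hmul : ∀ f ∈ isotypic G (θ ^ (fixerOrder G H - 1)),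
          z * f ∈ isotypic G (θ ^ (fixerOrder G H - 1) * detChar G))
        (tC : Module.IsTorsionBySet (invariantRing G)
          (CokerMul G z (θ ^ (fixerOrder G H - 1)) (θ ^ (fixerOrder G H - 1) * detChar G) hmul)
          (Ideal.span {Δ} : Ideal (invariantRing G))),
        letI := tC.module
        Nonempty
          (CokerMul G z (θ ^ (fixerOrder G H - 1)) (θ ^ (fixerOrder G H - 1) * detChar G) hmul
            ≃ₗ[invariantRing G ⧸ Ideal.span {Δ}] (invariantRing G ⧸ Ideal.span {ΔO})) ∧
        -- the map induced by the inclusion of the isotypical component in `S` identifies the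
        -- cokernel with a direct summand of `S/(z)`
        ∃ (P Q : Submodule (invariantRing G ⧸ Ideal.span {Δ}) (PolyRing n ⧸ Ideal.span {z}))
          (φ : CokerMul G z (θ ^ (fixerOrder G H - 1))
              (θ ^ (fixerOrder G H - 1) * detChar G) hmul
            ≃ₗ[invariantRing G ⧸ Ideal.span {Δ}] P),
          IsCompl P Q ∧
          ∀ f : isotypic G (θ ^ (fixerOrder G H - 1) * detChar G),
            (φ (Submodule.Quotient.mk f) : PolyRing n ⧸ Ideal.span {z}) =
              Ideal.Quotient.mk (Ideal.span {z}) (f : PolyRing n) := by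
  classical
  obtain ⟨A, hA⟩ := (finite_reflectingHyperplanes G).exists_finset_coe
  obtain ⟨B, rfl⟩ := ((finite_reflectingHyperplanes G).subset
    (subset_reflectingHyperplanes hO)).exists_finset_coe
  have hAall : ∀ H, H ∈ A ↔ H ∈ reflectingHyperplanes G := fun H => by
    rw [← hA, Finset.mem_coe]
  have hBA : B ⊆ A := fun K hK => (hAall K).mpr (subset_reflectingHyperplanes hO hK)
  have hstA : IsStableArrangement G α A :=
    ⟨fun K hK => (hAall K).mp hK, fun K hK => hα K ((hAall K).mp hK), fun g hg K hK =>
      (hAall _).mpr (map_mem_reflectingHyperplanes ((hAall K).mp hK) hg)⟩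
  have hstB : IsStableArrangement G α B :=
    ⟨fun K hK => hstA.subset K (hBA hK), fun K hK => hstA.form K (hBA hK),
      fun g hg K hK => map_mem_orbit hO hK hg⟩
  have hstC : IsStableArrangement G α (A \ B) :=
    ⟨fun K hK => hstA.subset K (Finset.sdiff_subset hK),
      fun K hK => hstA.form K (Finset.sdiff_subset hK), fun g hg K hK => by
        rw [Finset.mem_sdiff] at hK ⊢
        exact ⟨hstA.stable g hg K hK.1, fun h => hK.2 (mem_orbit_of_map_mem hO hg h)⟩⟩
  have hBC : ∀ H ∈ reflectingHyperplanes G, H ∈ A \ B ↔ H ∉ B := fun H hH => by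
    rw [Finset.mem_sdiff, hAall, and_iff_right hH]
  rw [← hA, finprod_mem_coe_finset] at hz
  simp only [← hA, finprod_mem_coe_finset]
  have hzdet : z ∈ isotypic G (detChar G) :=
    hz ▸ hstA.prod_mem_isotypic_detChar hG fun H hH => (hAall H).mpr hH
  have hzy : z = (∏ K ∈ A \ B, α K) * ∏ K ∈ B, α K := by rw [hz, Finset.prod_sdiff hBA]
  obtain ⟨θ, hθ⟩ := hstB.exists_character
  obtain ⟨H₀, hH₀⟩ : (B : Set (Submodule ℂ (Fin n → ℂ))).Nonempty :=
    nonempty_of_mem_hyperplaneOrbits hO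
  let Δ : invariantRing G := ⟨_, hstA.prod_pow_mem_invariantRing hG hα⟩
  let ΔO : invariantRing G := ⟨_, hstB.prod_pow_mem_invariantRing hG hα⟩
  -- The cofactor of `ΔO` in `Δ` must itself be invariant for `Δ` to kill `R/(ΔO)`.
  let ΔC : invariantRing G := ⟨_, hstC.prod_pow_mem_invariantRing hG hα⟩
  have hΔ : Δ = ΔC * ΔO := Subtype.ext (Finset.prod_sdiff hBA).symm
  have hzΔ : z ∣ (Δ : PolyRing n) := by
    rw [hz]
    exact Finset.prod_dvd_prod_of_dvd _ _ fun K _ => dvd_pow_self _ fixerOrder_pos.ne'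
  have tS : Module.IsTorsionBySet (invariantRing G) (PolyRing n ⧸ Ideal.span {z})
      (Ideal.span {Δ} : Ideal (invariantRing G)) := isTorsionBySet_span_singleton fun x => by
    obtain ⟨f, rfl⟩ := Ideal.Quotient.mk_surjective x
    exact Ideal.Quotient.eq_zero_iff_mem.mpr
      (Ideal.mem_span_singleton.mpr (hzΔ.mul_right f))
  have tO : Module.IsTorsionBySet (invariantRing G) (invariantRing G ⧸ Ideal.span {ΔO})
      (Ideal.span {Δ} : Ideal (invariantRing G)) := isTorsionBySet_span_singleton fun x => by
    obtain ⟨f, rfl⟩ := Ideal.Quotient.mk_surjective x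
    exact Ideal.Quotient.eq_zero_iff_mem.mpr
      (Ideal.mem_span_singleton.mpr ((Dvd.intro_left ΔC hΔ.symm).mul_right f))
  have main : ∀ H ∈ B,
      ∃ (hmul : ∀ f ∈ isotypic G (θ ^ (fixerOrder G H - 1)),
          z * f ∈ isotypic G (θ ^ (fixerOrder G H - 1) * detChar G))
        (tC : Module.IsTorsionBySet (invariantRing G)
          (CokerMul G z (θ ^ (fixerOrder G H - 1)) (θ ^ (fixerOrder G H - 1) * detChar G) hmul)
          (Ideal.span {Δ} : Ideal (invariantRing G))),
        letI := tC.module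
        letI := tS.module
        letI := tO.module
        Nonempty
          (CokerMul G z (θ ^ (fixerOrder G H - 1)) (θ ^ (fixerOrder G H - 1) * detChar G) hmul
            ≃ₗ[invariantRing G ⧸ Ideal.span {Δ}] (invariantRing G ⧸ Ideal.span {ΔO})) ∧
        ∃ (P Q : Submodule (invariantRing G ⧸ Ideal.span {Δ}) (PolyRing n ⧸ Ideal.span {z}))
          (φ : CokerMul G z (θ ^ (fixerOrder G H - 1))
              (θ ^ (fixerOrder G H - 1) * detChar G) hmul
            ≃ₗ[invariantRing G ⧸ Ideal.span {Δ}] P),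
          IsCompl P Q ∧
          ∀ f : isotypic G (θ ^ (fixerOrder G H - 1) * detChar G),
            (φ (Submodule.Quotient.mk f) : PolyRing n ⧸ Ideal.span {z}) =
              Ideal.Quotient.mk (Ideal.span {z}) (f : PolyRing n) := by
    intro H hH
    have he : ∀ K ∈ B, fixerOrder G K = fixerOrder G H :=
      fun K hK => fixerOrder_eq_of_mem_orbit hO hK hH
    have hpos : 0 < fixerOrder G H := fixerOrder_pos
    have hmul : ∀ f ∈ isotypic G (θ ^ (fixerOrder G H - 1)),
        z * f ∈ isotypic G (θ ^ (fixerOrder G H - 1) * detChar G) := fun f hf => by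
      rw [mul_comm z]
      exact mul_mem_isotypic hf hzdet
    -- Here `u = j ^ (e - 1)` and `y` is the product off the orbit; the last argument is `z j ^ (e -
    -- 1) = ΔO y`.
    obtain ⟨ε⟩ := nonempty_cokerMul_equiv (D := ΔO) hmul
      (pow_ne_zero _ hstB.prod_ne_zero) (pow_mem_isotypic hθ (fixerOrder G H - 1))
      (fun f hf => hstB.prod_pow_dvd hθ (fun K hK => by rw [he K hK]; omega) hf)
      hstC.prod_ne_zero (hstB.prod_compl_mem hG hα hstC hBC hθ hpos he)
      (fun f hf => hstB.prod_compl_dvd hα hstC hBC hθ hf) (by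
        have hΔO : (ΔO : PolyRing n) = (∏ K ∈ B, α K) ^ fixerOrder G H := by
          rw [← Finset.prod_pow]
          exact Finset.prod_congr rfl fun K hK => by rw [he K hK]
        rw [hΔO, hzy, mul_assoc, ← pow_succ', Nat.sub_add_cancel hpos, mul_comm])
    -- Annihilation by `Δ` is transported from `R/(ΔO)` along the `R`-linear isomorphism `ε`.
    have tC : Module.IsTorsionBySet (invariantRing G)
        (CokerMul G z (θ ^ (fixerOrder G H - 1)) (θ ^ (fixerOrder G H - 1) * detChar G) hmul)
        (Ideal.span {Δ} : Ideal (invariantRing G)) := fun x a => ε.injective (by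
      rw [map_smul, map_zero]
      exact @tO (ε x) a)
    obtain ⟨i, r, hir, hi⟩ := exists_cokerMul_retraction hzdet hmul
    let _ := tC.module
    let _ := tS.module
    let _ := tO.module
    obtain ⟨P, Q, φ, hPQ, hφ⟩ := exists_isCompl_of_retraction
      (quotientScalars tC tS i) (quotientScalars tS tC r) hir
    exact ⟨hmul, tC, ⟨quotientScalarsEquiv tC tO ε⟩, P, Q, φ, hPQ,
      fun f => (hφ _).trans (hi f)⟩
  refine ⟨Δ, ΔO, rfl, rfl, tS, tO, ?_, θ, hθ, main⟩
  -- The abstract summand statement follows from the precise one at any hyperplane of the nonempty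
  -- orbit.
  obtain ⟨hmul, tC, ⟨ε⟩, P, Q, φ, hPQ, -⟩ := main H₀ hH₀
  let _ := tC.module
  let _ := tS.module
  let _ := tO.module
  exact ⟨P, Q, hPQ, ⟨ε.symm.trans φ⟩⟩
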